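/- **Setting.** Let $1\le r\le H$. A server holding $N$ independent, uniformly distributed files $F_1,\dots,F_N$ of $B$ bits each is connected to $H$ relays. There are $K=\binom{H}{r}$ users, indexed by $[K]$; user $k$ is connected to a set $\mathcal H_k\subseteq[H]$ of $r$ relays, a different one for each user, and all links are noiseless. Assume $N\ge K$ and $0\le M\le N$. For $\mathcal J\subseteq[H]$ put $\mathcal K_{\mathcal J}=\{k\in[K]:\mathcal H_k\subseteq\mathcal J\}$. In an *uncoded placement* $\mathbf Z$ each user $k$ copies bits of the files into its cache; it respects the cache size $M$ if every user stores at most $MB$ bits. For $\mathcal W\subseteq[K]$ let $F_{i,\mathcal W}$ be the set of bits of $F_i$ cached by the users in $\mathcal W$ and by no other user, and let $$x_{\mathcal W}(\mathbf Z)=\frac1{NB}\sum_{i\in[N]}|F_{i,\mathcal W}|.$$ Given a demand vector $\mathbf d\in[N]^K$, the server sends bits $X_h$ (a function of the files, depending on $\mathbf d,\mathbf Z$) to each relay $h$, relay $h$ sends bits $X_{h\to k}$ (a function of $X_h$) to each user $k$ with $h\in\mathcal H_k$, and user $k$ estimates $F_{d_k}$ from its cache and $(X_{h\to k})_{h\in\mathcal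 H_k}$. Say that $\mathbf Z$ *supports* $(R,\varepsilon)$ if for every $\mathbf d$ this can be done with at most $RB$ bits on each of the links and with error probability at most $\varepsilon$ at each user. A load $R$ is achievable if for every $\varepsilon>0$ there are $B\ge1$ and an uncoded placement $\mathbf Z$ with cache size $M$ that supports $(R,\varepsilon)$; $R^\star_{\mathrm u}$ is the infimum of the achievable loads. A family $x=(x_{\mathcal W})_{\mathcal W\subseteq[K]}$ of reals is an *optimal profile* if for every $\varepsilon>0$ there are $B\ge1$ and an uncoded placement $\mathbf Z$ with cache size $M$ that supports $(R^\star_{\mathrm u}+\varepsilon,\varepsilon)$ and satisfies $|x_{\mathcal W}(\mathbf Z)-x_{\mathcal W}|\le\varepsilon$ for all $\mathcal W$. **Theorem.** Consider any set of relays $\mathcal Q\subseteq[H]$, any integer $1\le a\le\lfloor|\mathcal Q|/r\rfloor$, any partition of $\mathcal Q$ into disjoint blocks $\mathcal Q_1,\dots,\mathcal Q_a$ with $|\mathcal Q_i|\ge r$ for all $i$, and, with $\mathcal V=\bigcup_{i\in[a]}\mathcal K_{\mathcal Q_i}$, any orderings $\mathbf p(\mathcal K_{\mathcal Q_i})=(p_1(\mathcal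 K_{\mathcal Q_i}),p_2(\mathcal K_{\mathcal Q_i}),\dots)$, $i\in[a]$, and $\mathbf p(\mathcal K_{\mathcal Q}\setminus\mathcal V)$ of the elements of these sets. For a family $x$ put $$\Lambda(x)=\sum_{i\in[a]}\ \sum_{j=1}^{|\mathcal K_{\mathcal Q_i}|}\ \sum_{\mathcal W\subseteq[K]\setminus\{p_1(\mathcal K_{\mathcal Q_i}),\dots,p_j(\mathcal K_{\mathcal Q_i})\}}x_{\mathcal W}\;+\;\sum_{j=1}^{|\mathcal K_{\mathcal Q}\setminus\mathcal V|}\ \sum_{\mathcal W\subseteq([K]\setminus\mathcal V)\setminus\{p_1(\mathcal K_{\mathcal Q}\setminus\mathcal V),\dots,p_j(\mathcal K_{\mathcal Q}\setminus\mathcal V)\}}x_{\mathcal W}.$$ 1. An optimal profile exists. 2. Every optimal profile $x$ satisfies $x_{\mathcal W}\ge0$ for all $\mathcal W$, $\sum_{\mathcal W\subseteq[K]}x_{\mathcal W}=1$, $\sum_{\mathcal W\ni k}x_{\mathcal W}\le M/N$ for all $k\in[K]$, and, for all choices as above, $$|\mathcal Q|\,R^\star_{\mathrm u}\ \ge\ \Lambda(x).$$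 3. The bound holds for each placement together with its own load, up to a vanishing term: for every $\delta>0$ there is $\varepsilon>0$ such that for all $B\ge1$, all uncoded placements $\mathbf Z$, all $R$ such that $\mathbf Z$ supports $(R,\varepsilon)$, and all choices as above, $|\mathcal Q|R+\delta\ge\Lambda(x(\mathbf Z))$. -/

import Mathlib

open scoped BigOperators

noncomputable section

namespace CombinationNetwork

/-- Users of the combination network with `H` relays and parameter `r`: one user for each
`r`-element set of relays. The coercion `k.1` is the set of relays the user is connected to. -/
abbrev User (H r : ℕ) : Type := {s : Finset (Fin H) // s.card = r}

/-- The number `K` of users. -/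
theorem card_user (H r : ℕ) : Fintype.card (User H r) = H.choose r := by
  simp [User]

/-- `K_J`: the users all of whose relays lie in `J`. -/
def usersWithin {H : ℕ} (r : ℕ) (J : Finset (Fin H)) : Finset (User H r) :=
  Finset.univ.filter fun k => k.1 ⊆ J

/-- A realisation of the library: `N` files of `B` bits each. The files are independent and
uniform, so all probabilities are normalised counts over this finite type. -/
abbrev Library (N B : ℕ) : Type := Fin N → Fin B → Bool

/-- An uncoded placement: user `k` copies into its cache the bits at the positions in `Z k`,
the position `(i, b)` being the `b`-th bit of file `i`. -/
abbrev Placement (H r N B : ℕ) : Type := User H r → Finset (Fin N × Fin B)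

/-- Every cache holds at most `M * B` bits. -/
def Placement.CacheSize {H r N B : ℕ} (Z : Placement H r N B) (M : ℝ) : Prop :=
  ∀ k, ((Z k).card : ℝ) ≤ M * B

/-- `F_{i,W}`: the positions of the bits of file `i` that are cached by the users in `W` and by
no other user. -/
def Placement.subfile {H r N B : ℕ} (Z : Placement H r N B) (i : Fin N)
    (W : Finset (User H r)) : Finset (Fin B) :=
  Finset.univ.filter fun b => ∀ k, (i, b) ∈ Z k ↔ k ∈ W

/-- `x_W = (1 / (N B)) ∑ i, |F_{i,W}|`. -/
def Placement.frac {H r N B : ℕ} (Z : Placement H r N B) (W : Finset (User H r)) : ℝ :=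
  (∑ i : Fin N, ((Z.subfile i W).card : ℝ)) / ((N : ℝ) * (B : ℝ))

/-- The content of the cache of user `k` when the library is `F`. -/
def Placement.content {H r N B : ℕ} (Z : Placement H r N B) (k : User H r)
    (F : Library N B) : {p : Fin N × Fin B // p ∈ Z k} → Bool :=
  fun p => F p.1.1 p.1.2

/-- A delivery code for the placement `Z` (one such code is chosen for each demand vector):
the server sends `linkLen h` bits `X_h`, depending on the library, to relay `h`; relay `h` sends
`edgeLen k h` bits `X_{h → k}`, depending on `X_h`, to each user `k` connected to it; user `k`
forms an estimate of its requested file from its cache and from what its relays send. -/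
structure Delivery {H r N B : ℕ} (Z : Placement H r N B) where
  linkLen : Fin H → ℕ
  edgeLen : (k : User H r) → {h : Fin H // h ∈ k.1} → ℕ
  encode : (h : Fin H) → Library N B → (Fin (linkLen h) → Bool)
  forward : (k : User H r) → (h : {h : Fin H // h ∈ k.1}) →
    (Fin (linkLen h.1) → Bool) → (Fin (edgeLen k h) → Bool)
  decode : (k : User H r) → ({p : Fin N × Fin B // p ∈ Z k} → Bool) →
    ((h : {h : Fin H // h ∈ k.1}) → (Fin (edgeLen k h) → Bool)) → (Fin B → Bool)

/-- The estimate formed by user `k` when the library is `F`. -/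
def Delivery.estimate {H r N B : ℕ} {Z : Placement H r N B} (D : Delivery Z)
    (k : User H r) (F : Library N B) : Fin B → Bool :=
  D.decode k (Z.content k F) fun h => D.forward k h (D.encode h.1 F)

/-- The probability that the estimate of user `k` differs from file `i`. -/
def Delivery.errorProb {H r N B : ℕ} {Z : Placement H r N B} (D : Delivery Z)
    (k : User H r) (i : Fin N) : ℝ :=
  ((Finset.univ.filter fun F : Library N B => D.estimate k F ≠ F i).card : ℝ) /
    (Fintype.card (Library N B) : ℝ)

/-- Every link (server to relay, and relay to user) carries at most `R * B` bits. -/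
def Delivery.LoadLE {H r N B : ℕ} {Z : Placement H r N B} (D : Delivery Z) (R : ℝ) : Prop :=
  (∀ h, (D.linkLen h : ℝ) ≤ R * B) ∧ ∀ k h, (D.edgeLen k h : ℝ) ≤ R * B

/-- With the placement `Z`, all demand vectors (distinct or not) can be served with max-link
load at most `R` and with error probability at most `ε` at each user. -/
def Placement.Supports {H r N B : ℕ} (Z : Placement H r N B) (R ε : ℝ) : Prop :=
  ∀ d : User H r → Fin N, ∃ D : Delivery Z, D.LoadLE R ∧ ∀ k, D.errorProb k (d k) ≤ ε

/-- The load `R` is achievable with uncoded placement and caches of `M` files: for every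
tolerated error probability there is a file size and an uncoded placement supporting it. -/
def AchievableUncoded (H r N : ℕ) (M R : ℝ) : Prop :=
  ∀ ε : ℝ, 0 < ε → ∃ B : ℕ, 0 < B ∧ ∃ Z : Placement H r N B, Z.CacheSize M ∧ Z.Supports R ε

/-- `R*_u(M)`: the optimal max-link load under uncoded placement. -/
def optLoadUncoded (H r N : ℕ) (M : ℝ) : ℝ :=
  sInf {R : ℝ | AchievableUncoded H r N M R}

/-- The numbers `x_W` are the (limiting) sub-file fractions of uncoded placements that attain the
optimal load `R*_u(M)` with vanishing error probability. -/
def IsOptimalProfile {H r : ℕ} (N : ℕ) (M : ℝ) (x : Finset (User H r) → ℝ) : Prop :=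
  ∀ ε : ℝ, 0 < ε → ∃ B : ℕ, 0 < B ∧ ∃ Z : Placement H r N B, Z.CacheSize M ∧
    Z.Supports (optLoadUncoded H r N M + ε) ε ∧ ∀ W, |Z.frac W - x W| ≤ ε

/-- The list `p` is a permutation of the elements of `S`. -/
def IsPermutationOf {U : Type*} (p : List U) (S : Finset U) : Prop :=
  p.Nodup ∧ ∀ u, u ∈ p ↔ u ∈ S

/-- `∑_j ∑_{W ⊆ A \ {p_1, …, p_j}} x_W`, where `j` runs from `1` to the length of `p`. -/
def acyclicSum {U : Type*} [DecidableEq U] (x : Finset U → ℝ) (A : Finset U) (p : List U) : ℝ :=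
  ∑ j ∈ Finset.Icc 1 p.length, ∑ W ∈ (A \ (p.take j).toFinset).powerset, x W

/-- `Q` is the disjoint union of the blocks `P i`, each of which has at least `r` elements. -/
def IsBlockPartition {H a : ℕ} (r : ℕ) (Q : Finset (Fin H)) (P : Fin a → Finset (Fin H)) :
    Prop :=
  (∀ i, r ≤ (P i).card) ∧ (∀ i j, i ≠ j → Disjoint (P i) (P j)) ∧ Finset.univ.biUnion P = Q

/-- `V`: the users all of whose relays lie in a single block. -/
def blockUsers {H a : ℕ} (r : ℕ) (P : Fin a → Finset (Fin H)) : Finset (User H r) :=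
  Finset.univ.biUnion fun i => usersWithin r (P i)

end CombinationNetwork

end

/-! Why the bound holds. Entropy is computed by counting over the finite type of libraries. Serve
distinct demands and look at the bits sent to the relays of a block. A user of that block, given its
cache, recovers its file from them up to Fano's term. Revealing that cache and file therefore lowers
the conditional entropy of the bits by the part of the file cached neither by this user nor by the
users treated before it. Running through the ordering of the block produces the block's sum and
leaves a remaining conditional entropy (`sum_condEntropy_sent_ge`).

The remainders are not thrown away. Each is at least the entropy conditioned on what all of
`blockUsers` know, and by conditional subadditivity their sum is at least the entropy of everything
sent to `Q` under that conditioning. The same argument applied to the users outside the blocks gives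
the last sum. On the other side, the unconditioned block entropies add up to at most `#Q * R * B`
bits, because the blocks are disjoint (`acyclicSum_le_of_supports`).

Summing over the `N` cyclic shifts of an injective demand replaces the sizes of parts of individual
files by `frac`. Fano's term, divided by `B`, is small uniformly in `B`
(`exists_error_acyclicSum_le`), so the bound passes to limits of placements. Optimal profiles exist
by compactness. -/

open Finset

namespace CombinationNetwork

/-! ### Entropy by counting: Gibbs, submodularity, Fano. -/

section Entropy

variable {Ω α β γ : Type*} [Fintype Ω]

open Classical in
/-- The number of outcomes at which `f` takes the value `a`. -/
noncomputable def fiberCard (f : Ω → α) (a : α) : ℕ := #{ω | f ω = a}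

/-- The Shannon entropy (in nats) of `f` under the uniform distribution on `Ω`. -/
noncomputable def entropy (f : Ω → α) : ℝ :=
  (∑ ω, (Real.log (Fintype.card Ω) - Real.log (fiberCard f (f ω)))) / Fintype.card Ω

theorem fiberCard_pos (f : Ω → α) (ω : Ω) : 0 < fiberCard f (f ω) := by
  classical
  exact Finset.card_pos.2 ⟨ω, by simp⟩

theorem fiberCard_le_of_determines {f : Ω → α} {g : Ω → β}
    (h : ∀ ω ω', g ω = g ω' → f ω = f ω') (ω : Ω) :
    fiberCard g (g ω) ≤ fiberCard f (f ω) := by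
  classical
  unfold fiberCard
  refine Finset.card_le_card fun ω' hω' => ?_
  simp only [Finset.mem_filter, Finset.mem_univ, true_and] at hω' ⊢
  exact h _ _ hω'

/-- The fibres of `g` lie inside those of `f`, so every summand grows. Functional dependence is
stated on pairs of outcomes, so no map from `β` to `α` has to be exhibited. -/
theorem entropy_mono {f : Ω → α} {g : Ω → β} (h : ∀ ω ω', g ω = g ω' → f ω = f ω') :
    entropy f ≤ entropy g := by
  unfold entropy
  gcongr with ω
  · exact_mod_cast fiberCard_pos g ω
  · exact_mod_cast fiberCard_le_of_determines h ω

theorem entropy_congr {f : Ω → α} {g : Ω → β} (h : ∀ ω ω', f ω = f ω' ↔ g ω = g ω') :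
    entropy f = entropy g :=
  le_antisymm (entropy_mono fun ω ω' => (h ω ω').2) (entropy_mono fun ω ω' => (h ω ω').1)

theorem entropy_const (c : α) : entropy (fun _ : Ω => c) = 0 := by
  simp [entropy, fiberCard, Finset.card_univ]

/-- Gibbs' inequality: the conditional entropy of `f` given `g` is at most the mean logarithmic
loss of any conditional (sub-)distribution `q`. -/
theorem entropy_prodMk_sub_le [Fintype α] (f : Ω → α) (g : Ω → β) (q : α → β → ℝ)
    (hq : ∀ a b, 0 ≤ q a b) (hpos : ∀ ω, 0 < q (f ω) (g ω))
    (hsum : ∀ ω, ∑ a, q a (g ω) ≤ 1) :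
    entropy (fun ω => (f ω, g ω)) - entropy g ≤
      (∑ ω, -Real.log (q (f ω) (g ω))) / Fintype.card Ω := by
  classical
  have hn : ∀ ω, (0 : ℝ) < fiberCard (fun ω => (f ω, g ω)) (f ω, g ω) := fun ω => by
    exact_mod_cast fiberCard_pos (fun ω => (f ω, g ω)) ω
  have hg : ∀ ω, (0 : ℝ) < fiberCard g (g ω) := fun ω => by exact_mod_cast fiberCard_pos g ω
  -- Grouping by the value `a` of `f`, a nonempty joint fibre contributes exactly `q a b` and an
  -- empty one contributes `0`.
  have hfib : ∀ b, (∑ ω with g ω = b, q (f ω) b / fiberCard (fun ω => (f ω, g ω)) (f ω, b))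
      ≤ ∑ a, q a b := by
    intro b
    rw [← Finset.sum_fiberwise (s := ({ω | g ω = b} : Finset Ω)) (g := f)]
    refine Finset.sum_le_sum fun a _ => ?_
    have h1 : ∀ ω ∈ ({ω ∈ ({ω | g ω = b} : Finset Ω) | f ω = a} : Finset Ω),
        q (f ω) b / (fiberCard (fun ω => (f ω, g ω)) (f ω, b) : ℝ) =
        q a b / (fiberCard (fun ω => (f ω, g ω)) (a, b) : ℝ) := by
      intro ω hω
      rw [(Finset.mem_filter.1 hω).2]
    rw [Finset.sum_congr rfl h1, Finset.sum_const]
    have h2 : #({ω ∈ ({ω | g ω = b} : Finset Ω) | f ω = a} : Finset Ω) =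
        fiberCard (fun ω => (f ω, g ω)) (a, b) := by
      unfold fiberCard
      congr 1
      ext ω
      simp [and_comm]
    rw [h2, nsmul_eq_mul]
    rcases Nat.eq_zero_or_pos (fiberCard (fun ω => (f ω, g ω)) (a, b)) with h0 | h0
    · simp [h0, hq]
    · have : (fiberCard (fun ω => (f ω, g ω)) (a, b) : ℝ) ≠ 0 := by positivity
      rw [mul_div_cancel₀ _ this]
  -- Double counting: the factor `fiberCard g (g ω)` becomes a sum over the `ω'` in the same
  -- `g`-fibre, and the two sums are exchanged.
  have hswap : ∑ ω, q (f ω) (g ω) * fiberCard g (g ω) /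
      fiberCard (fun ω => (f ω, g ω)) (f ω, g ω) ≤ Fintype.card Ω := by
    calc _ = ∑ ω, ∑ ω', if g ω = g ω' then q (f ω) (g ω') /
            fiberCard (fun ω => (f ω, g ω)) (f ω, g ω') else 0 := by
          refine Finset.sum_congr rfl fun ω _ => ?_
          have : ∀ ω', (if g ω = g ω' then q (f ω) (g ω') /
              (fiberCard (fun ω => (f ω, g ω)) (f ω, g ω') : ℝ) else 0) =
              if g ω' = g ω then q (f ω) (g ω) /
              (fiberCard (fun ω => (f ω, g ω)) (f ω, g ω) : ℝ) else 0 := by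
            intro ω'
            by_cases h : g ω = g ω'
            · simp [h]
            · simp [h, Ne.symm h]
          rw [Finset.sum_congr rfl fun ω' _ => this ω', ← Finset.sum_filter, Finset.sum_const,
            nsmul_eq_mul]
          unfold fiberCard
          ring
      _ = ∑ ω', ∑ ω with g ω = g ω', q (f ω) (g ω') /
            fiberCard (fun ω => (f ω, g ω)) (f ω, g ω') := by
          rw [Finset.sum_comm]
          simp_rw [Finset.sum_filter]
      _ ≤ ∑ _ω' : Ω, (1 : ℝ) := Finset.sum_le_sum fun ω' _ => (hfib _).trans (hsum ω')
      _ = Fintype.card Ω := by simp [Finset.card_univ]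
  have hterm : ∀ ω, Real.log (fiberCard g (g ω)) -
      Real.log (fiberCard (fun ω => (f ω, g ω)) (f ω, g ω)) + Real.log (q (f ω) (g ω)) ≤
      q (f ω) (g ω) * fiberCard g (g ω) / fiberCard (fun ω => (f ω, g ω)) (f ω, g ω) - 1 := by
    intro ω
    have := Real.log_le_sub_one_of_pos (div_pos (mul_pos (hpos ω) (hg ω)) (hn ω))
    rw [Real.log_div (mul_pos (hpos ω) (hg ω)).ne' (hn ω).ne',
      Real.log_mul (hpos ω).ne' (hg ω).ne'] at this
    linarith
  unfold entropy
  rw [← sub_div, ← Finset.sum_sub_distrib]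
  gcongr ?_ / _
  have h3 := Finset.sum_le_sum fun ω (_ : ω ∈ (Finset.univ : Finset Ω)) => hterm ω
  rw [Finset.sum_sub_distrib (f := fun ω => q (f ω) (g ω) * (fiberCard g (g ω) : ℝ) /
    fiberCard (fun ω => (f ω, g ω)) (f ω, g ω))] at h3
  simp only [Finset.sum_const, Finset.card_univ, nsmul_eq_mul, mul_one] at h3
  rw [← sub_nonpos, ← Finset.sum_sub_distrib]
  refine le_trans (le_of_eq (Finset.sum_congr rfl fun ω _ => ?_)) (h3.trans (by linarith))
  ring

/-- Submodularity of entropy: conditioning on more reduces entropy. -/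
theorem entropy_submodular [Fintype α] (f : Ω → α) (g : Ω → β) (h : Ω → γ) :
    entropy (fun ω => (f ω, g ω, h ω)) + entropy g ≤
      entropy (fun ω => (f ω, g ω)) + entropy (fun ω => (g ω, h ω)) := by
  classical
  -- The test law is the true conditional law of `f` given `g` alone; its loss is exactly the
  -- conditional entropy given `g`.
  have key := entropy_prodMk_sub_le f (fun ω => (g ω, h ω))
    (fun a b => (fiberCard (fun ω => (f ω, g ω)) (a, b.1) : ℝ) / fiberCard g b.1)
    (fun a b => by positivity)
    (fun ω => div_pos (by exact_mod_cast fiberCard_pos (fun ω => (f ω, g ω)) ω)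
      (by exact_mod_cast fiberCard_pos g ω))
    (fun ω => by
      rw [← Finset.sum_div]
      refine div_le_one_of_le₀ ?_ (by positivity)
      rw [← Nat.cast_sum, Nat.cast_le]
      unfold fiberCard
      rw [Finset.card_eq_sum_card_fiberwise (f := f) (t := Finset.univ) (by simp)]
      refine le_of_eq (Finset.sum_congr rfl fun a _ => congrArg _ ?_)
      ext ω'
      simp [and_comm])
  have h2 : (∑ ω, -Real.log ((fiberCard (fun ω => (f ω, g ω)) (f ω, g ω) : ℝ) /
      fiberCard g (g ω))) / Fintype.card Ω =
      entropy (fun ω => (f ω, g ω)) - entropy g := by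
    unfold entropy
    rw [← sub_div, ← Finset.sum_sub_distrib]
    congr 1
    refine Finset.sum_congr rfl fun ω _ => ?_
    rw [Real.log_div (by exact_mod_cast (fiberCard_pos (fun ω => (f ω, g ω)) ω).ne')
      (by exact_mod_cast (fiberCard_pos g ω).ne')]
    ring
  rw [h2] at key
  linarith

theorem entropy_le_log_card [Nonempty Ω] [Fintype α] (f : Ω → α) :
    entropy f ≤ Real.log (Fintype.card α) := by
  have : Nonempty α := ⟨f (Classical.arbitrary Ω)⟩
  have hα : (0 : ℝ) < Fintype.card α := by exact_mod_cast Fintype.card_pos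
  have hΩ : (Fintype.card Ω : ℝ) ≠ 0 := by exact_mod_cast Fintype.card_ne_zero
  -- Gibbs with trivial side information and the uniform law.
  have key := entropy_prodMk_sub_le f (fun _ => ()) (fun _ _ => (Fintype.card α : ℝ)⁻¹)
    (fun _ _ => by positivity) (fun _ => by positivity)
    (fun _ => by simp [Finset.card_univ])
  rw [entropy_const, sub_zero] at key
  rw [entropy_congr (g := fun ω => (f ω, ())) (by simp)]
  refine key.trans (le_of_eq ?_)
  simp [Finset.card_univ, hΩ]

open Classical in
/-- A form of Fano's inequality, with a free parameter `η`. -/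
theorem entropy_prodMk_sub_le_of_decode [Nonempty Ω] [Fintype α] (f : Ω → α) (g : Ω → β)
    (φ : β → α) {ε η : ℝ} (hη₀ : 0 < η) (hη₁ : η < 1)
    (herr : (#{ω | φ (g ω) ≠ f ω} : ℝ) / Fintype.card Ω ≤ ε) :
    entropy (fun ω => (f ω, g ω)) - entropy g ≤
      -Real.log (1 - η) + ε * (Real.log (Fintype.card α) - Real.log η) := by
  have : Nonempty α := ⟨f (Classical.arbitrary Ω)⟩
  have hα : (0 : ℝ) < Fintype.card α := by exact_mod_cast Fintype.card_pos
  have hα1 : (1 : ℝ) ≤ Fintype.card α := by exact_mod_cast Fintype.card_pos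
  have hΩ : (0 : ℝ) < Fintype.card Ω := by exact_mod_cast Fintype.card_pos
  have hL : 0 ≤ -Real.log (1 - η) := by
    have := Real.log_nonpos (by linarith : 0 ≤ 1 - η) (by linarith)
    linarith
  have hE : 0 ≤ Real.log (Fintype.card α) - Real.log η := by
    have := Real.log_nonneg hα1
    have := Real.log_nonpos hη₀.le hη₁.le
    linarith
  have hq : ∀ a b, 0 < (if φ b = a then 1 - η else η / Fintype.card α : ℝ) := by
    intro a b
    split_ifs
    · linarith
    · positivity
  -- The test law puts `1 - η` on the decoded value and `η / card α` on every other one, so the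
  -- large loss is paid only on decoding errors.
  refine (entropy_prodMk_sub_le f g (fun a b => if φ b = a then 1 - η else η / Fintype.card α)
    (fun a b => (hq a b).le) (fun ω => hq _ _) (fun ω => ?_)).trans ?_
  · calc _ ≤ ∑ a, ((if φ (g ω) = a then 1 - η else 0) + η / Fintype.card α) := by
          refine Finset.sum_le_sum fun a _ => ?_
          split_ifs
          · linarith [div_pos hη₀ hα]
          · linarith
      _ = 1 := by
          rw [Finset.sum_add_distrib]
          simp only [Finset.sum_ite_eq, Finset.mem_univ, if_true, Finset.sum_const,
            Finset.card_univ, nsmul_eq_mul]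
          field_simp
          ring
  · have hs : (∑ ω, -Real.log (if φ (g ω) = f ω then 1 - η else η / Fintype.card α)) ≤
        ∑ ω, (-Real.log (1 - η) +
          if φ (g ω) ≠ f ω then (Real.log (Fintype.card α) - Real.log η) else 0) := by
      refine Finset.sum_le_sum fun ω _ => ?_
      by_cases h : φ (g ω) = f ω
      · simp [h]
      · simp only [h, if_false, ne_eq, not_false_eq_true, if_true]
        rw [Real.log_div hη₀.ne' hα.ne']
        linarith
    rw [Finset.sum_add_distrib, ← Finset.sum_filter, Finset.sum_const, Finset.sum_const,
      Finset.card_univ, nsmul_eq_mul, nsmul_eq_mul] at hs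
    refine (div_le_div_of_nonneg_right hs hΩ.le).trans ?_
    rw [add_div, mul_div_cancel_left₀ _ hΩ.ne', mul_div_right_comm]
    gcongr

end Entropy

/-! ### Conditional entropy given bits of the library. -/

section Library

variable {N B : ℕ} {α β γ : Type*}

/-- The bits of the library at the positions in `T`. -/
def bitsAt (T : Finset (Fin N × Fin B)) (F : Library N B) : {p // p ∈ T} → Bool :=
  fun p => F p.1.1 p.1.2

theorem bitsAt_eq_iff {T : Finset (Fin N × Fin B)} {F F' : Library N B} :
    bitsAt T F = bitsAt T F' ↔ ∀ p ∈ T, F p.1 p.2 = F' p.1 p.2 := by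
  simp [bitsAt, funext_iff]

theorem fiberCard_bitsAt (T : Finset (Fin N × Fin B)) (F : Library N B) :
    fiberCard (bitsAt T) (bitsAt T F) = 2 ^ #Tᶜ := by
  classical
  -- The fibre is a box: one value at each position in `T`, both values elsewhere.
  have h : ({F' | bitsAt T F' = bitsAt T F} : Finset (Library N B)) =
      Fintype.piFinset fun i => Fintype.piFinset fun b =>
        if (i, b) ∈ T then {F i b} else Finset.univ := by
    ext F'
    simp only [Finset.mem_filter, Finset.mem_univ, true_and, bitsAt_eq_iff, Fintype.mem_piFinset,
      Prod.forall]
    refine forall₂_congr fun i b => ?_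
    by_cases hb : (i, b) ∈ T <;> simp [hb]
  have h' : fiberCard (bitsAt T) (bitsAt T F) =
      #({F' | bitsAt T F' = bitsAt T F} : Finset (Library N B)) := by
    unfold fiberCard
    congr!
  rw [h', h]
  simp only [Fintype.card_piFinset]
  rw [← Fintype.prod_prod_type' (f := fun i b =>
    #(if (i, b) ∈ T then ({F i b} : Finset Bool) else Finset.univ))]
  have h2 : ∀ p : Fin N × Fin B,
      #(if (p.1, p.2) ∈ T then ({F p.1 p.2} : Finset Bool) else Finset.univ) =
      if p ∈ Tᶜ then 2 else 1 := by
    intro p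
    by_cases hp : p ∈ T <;> simp [hp]
  rw [Finset.prod_congr rfl fun p _ => h2 p, Finset.prod_ite_mem, Finset.univ_inter,
    Finset.prod_const]

theorem entropy_bitsAt (T : Finset (Fin N × Fin B)) :
    entropy (bitsAt T) = #T * Real.log 2 := by
  have hc : Fintype.card (Library N B) = 2 ^ (N * B) := by
    simp [Library, ← pow_mul, mul_comm]
  have hT : #T + #Tᶜ = N * B := by
    rw [Finset.card_add_card_compl]; simp
  have hT' : (#T : ℝ) + #Tᶜ = (N * B : ℕ) := by exact_mod_cast hT
  have h0 : (Fintype.card (Library N B) : ℝ) ≠ 0 := by exact_mod_cast Fintype.card_ne_zero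
  unfold entropy
  simp_rw [fiberCard_bitsAt]
  rw [Finset.sum_const, Finset.card_univ, nsmul_eq_mul, mul_div_cancel_left₀ _ h0, hc]
  push_cast
  rw [Real.log_pow, Real.log_pow, ← hT']
  ring

/-- The conditional entropy of `X` given the bits of the library at the positions in `T`. -/
noncomputable def condEntropy (X : Library N B → α) (T : Finset (Fin N × Fin B)) : ℝ :=
  entropy (fun F => (X F, bitsAt T F)) - #T * Real.log 2

theorem condEntropy_nonneg (X : Library N B → α) (T : Finset (Fin N × Fin B)) :
    0 ≤ condEntropy X T := by
  unfold condEntropy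
  rw [← entropy_bitsAt, sub_nonneg]
  exact entropy_mono fun F F' h => (Prod.ext_iff.1 h).2

theorem condEntropy_anti [Fintype α] (X : Library N B → α) {T T' : Finset (Fin N × Fin B)}
    (h : T ⊆ T') : condEntropy X T' ≤ condEntropy X T := by
  have key := entropy_submodular X (bitsAt T) (bitsAt T')
  have h1 : entropy (fun F => (X F, bitsAt T F, bitsAt T' F)) =
      entropy (fun F => (X F, bitsAt T' F)) := by
    refine entropy_congr fun F F' => ?_
    simp only [Prod.mk.injEq, bitsAt_eq_iff]
    exact ⟨fun h' => ⟨h'.1, h'.2.2⟩, fun h' => ⟨h'.1, fun p hp => h'.2 p (h hp), h'.2⟩⟩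
  have h2 : entropy (fun F => (bitsAt T F, bitsAt T' F)) = entropy (bitsAt (N := N) T') := by
    refine entropy_congr fun F F' => ?_
    simp only [Prod.mk.injEq, bitsAt_eq_iff]
    exact ⟨fun h' => h'.2, fun h' => ⟨fun p hp => h' p (h hp), h'⟩⟩
  rw [h1, h2, entropy_bitsAt, entropy_bitsAt] at key
  unfold condEntropy
  linarith

/-- Submodularity with `bitsAt T` as the shared variable. Allowing any `W` determined by the pair
avoids identifying the bits sent to a union of relays with a product. -/
theorem condEntropy_le_add [Fintype α] (X : Library N B → α) (Y : Library N B → β)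
    (W : Library N B → γ) (T : Finset (Fin N × Fin B))
    (hW : ∀ F F', X F = X F' → Y F = Y F' → W F = W F') :
    condEntropy W T ≤ condEntropy X T + condEntropy Y T := by
  have key := entropy_submodular X (bitsAt T) Y
  have h1 : entropy (fun F => (W F, bitsAt T F)) ≤ entropy (fun F => (X F, bitsAt T F, Y F)) := by
    refine entropy_mono fun F F' h => ?_
    simp only [Prod.mk.injEq] at h ⊢
    exact ⟨hW _ _ h.1 h.2.2, h.2.1⟩
  have h2 : entropy (fun F => (bitsAt T F, Y F)) = entropy (fun F => (Y F, bitsAt T F)) :=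
    entropy_congr fun F F' => by simp [and_comm]
  rw [h2, entropy_bitsAt] at key
  unfold condEntropy
  linarith

theorem condEntropy_empty (X : Library N B → α) : condEntropy X ∅ = entropy X := by
  unfold condEntropy
  rw [Finset.card_empty, Nat.cast_zero, zero_mul, sub_zero]
  exact entropy_congr fun F F' => by simp [bitsAt_eq_iff]

/-- The positions of the bits of file `i`. -/
def filePositions (i : Fin N) : Finset (Fin N × Fin B) := {p | p.1 = i}

/-- If file `i` can be recovered from `X` and the bits in `T`, then revealing it reduces the
conditional entropy of `X` by at least the number of its bits outside `T`, up to Fano's term. -/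
theorem condEntropy_decode (X : Library N B → α) (T : Finset (Fin N × Fin B)) (i : Fin N)
    (φ : α × ({p // p ∈ T} → Bool) → Fin B → Bool) {ε η : ℝ} (hη₀ : 0 < η) (hη₁ : η < 1)
    (herr : (#{F : Library N B | φ (X F, bitsAt T F) ≠ F i} : ℝ) /
      Fintype.card (Library N B) ≤ ε) :
    #(filePositions i \ T) * Real.log 2 + condEntropy X (T ∪ filePositions i) ≤
      condEntropy X T + (-Real.log (1 - η) + ε * (B * Real.log 2 - Real.log η)) := by
  classical
  have key := entropy_prodMk_sub_le_of_decode (fun F : Library N B => F i)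
    (fun F => (X F, bitsAt T F)) φ hη₀ hη₁ (by convert herr)
  have h1 : entropy (fun F : Library N B => (F i, X F, bitsAt T F)) =
      entropy (fun F => (X F, bitsAt (T ∪ filePositions i) F)) := by
    refine entropy_congr fun F F' => ?_
    simp only [Prod.mk.injEq, bitsAt_eq_iff, Finset.mem_union, filePositions, Finset.mem_filter,
      Finset.mem_univ, true_and, Prod.forall]
    constructor
    · rintro ⟨h1, h2, h3⟩
      refine ⟨h2, fun j b h => h.elim (h3 j b) ?_⟩
      rintro rfl
      exact congrFun h1 b
    · rintro ⟨h1, h2⟩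
      exact ⟨funext fun b => h2 i b (Or.inr rfl), h1, fun j b h => h2 j b (Or.inl h)⟩
  have h2 : Real.log (Fintype.card (Fin B → Bool)) = B * Real.log 2 := by
    simp
  have h3 : #(T ∪ filePositions i) = #T + #(filePositions i \ T) := by
    rw [← Finset.union_sdiff_self_eq_union, Finset.card_union_of_disjoint Finset.disjoint_sdiff]
  rw [h1, h2] at key
  unfold condEntropy
  rw [h3]
  push_cast
  linarith

end Library

/-! ### Placements, transmitted bits and decoding. -/

section Network

variable {H r N B : ℕ}

/-- The set of users caching the bit at the position `p`. -/
def Placement.owners (Z : Placement H r N B) (p : Fin N × Fin B) : Finset (User H r) :=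
  {k | p ∈ Z k}

theorem Placement.subfile_eq (Z : Placement H r N B) (i : Fin N) (W : Finset (User H r)) :
    Z.subfile i W = ({b | Z.owners (i, b) = W} : Finset (Fin B)) := by
  ext b
  simp [Placement.subfile, Placement.owners, Finset.ext_iff]

theorem Placement.sum_card_subfile (Z : Placement H r N B) (i : Fin N)
    (S : Finset (Finset (User H r))) :
    ∑ W ∈ S, #(Z.subfile i W) = #{b | Z.owners (i, b) ∈ S} := by
  rw [Finset.card_eq_sum_card_fiberwise (f := fun b => Z.owners (i, b)) (t := S)
    (by intro b; simp)]
  refine Finset.sum_congr rfl fun W hW => congrArg _ ?_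
  rw [Z.subfile_eq]
  ext b
  simp only [Finset.mem_filter, Finset.mem_univ, true_and]
  exact ⟨fun h => ⟨h ▸ hW, h⟩, fun h => h.2⟩

/-- Each position belongs to exactly one sub-file, indexed by its `owners`, so sums of `frac` count
positions. -/
theorem Placement.sum_frac (Z : Placement H r N B) (S : Finset (Finset (User H r))) :
    ∑ W ∈ S, Z.frac W = (#{p | Z.owners p ∈ S} : ℝ) / ((N : ℝ) * B) := by
  unfold Placement.frac
  rw [← Finset.sum_div, Finset.sum_comm]
  congr 1
  have h : ∀ i, ∑ W ∈ S, (#(Z.subfile i W) : ℝ) = (#{b | Z.owners (i, b) ∈ S} : ℝ) := fun i => by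
    exact_mod_cast Z.sum_card_subfile i S
  rw [Finset.sum_congr rfl fun i _ => h i]
  norm_cast
  simp only [Finset.card_filter]
  rw [Fintype.sum_prod_type]

theorem Placement.frac_nonneg (Z : Placement H r N B) (W : Finset (User H r)) :
    0 ≤ Z.frac W := by
  unfold Placement.frac; positivity

theorem Placement.sum_frac_univ (Z : Placement H r N B) (hN : 0 < N) (hB : 0 < B) :
    ∑ W, Z.frac W = 1 := by
  rw [Z.sum_frac]
  simp only [Finset.mem_univ, Finset.filter_true, Finset.card_univ, Fintype.card_prod,
    Fintype.card_fin]
  push_cast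
  exact div_self (by positivity)

theorem Placement.frac_le_one (Z : Placement H r N B) (hN : 0 < N) (hB : 0 < B)
    (W : Finset (User H r)) : Z.frac W ≤ 1 := by
  rw [← Z.sum_frac_univ hN hB]
  exact Finset.single_le_sum (fun W _ => Z.frac_nonneg W) (Finset.mem_univ W)

theorem Placement.CacheSize.sum_frac_le {Z : Placement H r N B} {M : ℝ} (hZ : Z.CacheSize M)
    (hN : 0 < N) (hB : 0 < B) (k : User H r) : ∑ W with k ∈ W, Z.frac W ≤ M / N := by
  rw [Z.sum_frac]
  have h : ({p | Z.owners p ∈ ({W | k ∈ W} : Finset (Finset (User H r)))} :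
      Finset (Fin N × Fin B)) = Z k := by
    ext p; simp [Placement.owners]
  rw [h, div_le_div_iff₀ (by positivity) (by positivity)]
  have := mul_le_mul_of_nonneg_right (hZ k) (Nat.cast_nonneg (α := ℝ) N)
  linarith

theorem Placement.Supports.mono {Z : Placement H r N B} {R R' ε ε' : ℝ} (h : Z.Supports R ε)
    (hR : R ≤ R') (hε : ε ≤ ε') : Z.Supports R' ε' := by
  intro d
  obtain ⟨D, ⟨h1, h2⟩, h3⟩ := h d
  have : R * B ≤ R' * B := by gcongr
  exact ⟨D, ⟨fun h => (h1 h).trans this, fun k h => (h2 k h).trans this⟩,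
    fun k => (h3 k).trans hε⟩

/-- The bits sent by the server to the relays in `J`. -/
def Delivery.sent {Z : Placement H r N B} (D : Delivery Z) (J : Finset (Fin H))
    (F : Library N B) : (h : {h // h ∈ J}) → Fin (D.linkLen h.1) → Bool :=
  fun h => D.encode h.1 F

theorem Delivery.sent_eq_iff {Z : Placement H r N B} {D : Delivery Z} {J : Finset (Fin H)}
    {F F' : Library N B} :
    D.sent J F = D.sent J F' ↔ ∀ h ∈ J, D.encode h F = D.encode h F' := by
  simp [Delivery.sent, funext_iff]

theorem Delivery.condEntropy_sent_union_le {Z : Placement H r N B} (D : Delivery Z)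
    (J J' : Finset (Fin H)) (T : Finset (Fin N × Fin B)) :
    condEntropy (D.sent (J ∪ J')) T ≤
      condEntropy (D.sent J) T + condEntropy (D.sent J') T := by
  refine condEntropy_le_add _ _ _ _ fun F F' h h' => ?_
  rw [Delivery.sent_eq_iff] at *
  intro k hk
  exact (Finset.mem_union.1 hk).elim (h k) (h' k)

theorem Delivery.condEntropy_sent_biUnion_le {Z : Placement H r N B} (D : Delivery Z)
    {ι : Type*} [DecidableEq ι] (S : Finset ι) (P : ι → Finset (Fin H))
    (T : Finset (Fin N × Fin B)) :
    condEntropy (D.sent (S.biUnion P)) T ≤ ∑ i ∈ S, condEntropy (D.sent (P i)) T := by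
  induction S using Finset.induction_on with
  | empty =>
    have h : entropy (fun F => (D.sent ((∅ : Finset ι).biUnion P) F, bitsAt T F)) =
        entropy (bitsAt (N := N) T) := by
      refine entropy_congr fun F F' => ?_
      simp [Delivery.sent_eq_iff]
    simp only [Finset.sum_empty]
    unfold condEntropy
    rw [h, entropy_bitsAt, sub_self]
  | insert i S hi ih =>
    rw [Finset.sum_insert hi, Finset.biUnion_insert]
    exact (D.condEntropy_sent_union_le _ _ _).trans (by linarith)

/-- Only the server-to-relay links enter the converse: what a relay forwards is a function of what
it received. -/
theorem Delivery.entropy_sent_le {Z : Placement H r N B} (D : Delivery Z) {R : ℝ}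
    (hD : D.LoadLE R) (Q : Finset (Fin H)) :
    condEntropy (D.sent Q) ∅ ≤ #Q * (R * B * Real.log 2) := by
  have h1 := D.condEntropy_sent_biUnion_le Q (fun h => {h}) ∅
  rw [Finset.biUnion_singleton_eq_self] at h1
  refine h1.trans ?_
  rw [← nsmul_eq_mul]
  refine Finset.sum_le_card_nsmul _ _ _ fun h _ => ?_
  have h2 : entropy (D.sent {h}) = entropy (D.encode h) :=
    entropy_congr fun F F' => by simp [Delivery.sent_eq_iff]
  rw [condEntropy_empty, h2]
  refine (entropy_le_log_card _).trans ?_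
  simp only [Fintype.card_pi, Fintype.card_bool, Finset.prod_const, Finset.card_univ,
    Fintype.card_fin, Nat.cast_pow, Nat.cast_ofNat, Real.log_pow]
  exact mul_le_mul_of_nonneg_right (hD.1 h) (Real.log_nonneg (by norm_num))

/-- The positions of the bits known to the users in `V` after decoding, when the demands
are `d`. -/
def Placement.known (Z : Placement H r N B) (d : User H r → Fin N) (V : Finset (User H r)) :
    Finset (Fin N × Fin B) :=
  {p | ∃ k ∈ V, p ∈ Z k ∨ p.1 = d k}

theorem Placement.known_mono (Z : Placement H r N B) (d : User H r → Fin N)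
    {V V' : Finset (User H r)} (h : V ⊆ V') : Z.known d V ⊆ Z.known d V' := by
  intro p
  simp only [Placement.known, Finset.mem_filter, Finset.mem_univ, true_and]
  rintro ⟨k, hk, hp⟩
  exact ⟨k, h hk, hp⟩

theorem Placement.known_insert (Z : Placement H r N B) (d : User H r → Fin N)
    (V : Finset (User H r)) (u : User H r) :
    Z.known d (insert u V) = (Z.known d V ∪ Z u) ∪ filePositions (d u) := by
  ext p
  simp only [Placement.known, filePositions, Finset.mem_filter, Finset.mem_univ, true_and,
    Finset.mem_union, Finset.mem_insert, exists_eq_or_imp]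
  exact or_comm.trans or_assoc.symm

/-- By injectivity of `d` no user in `V` requests file `d u`, so its bits are known only through
caches: the unknown ones are those whose owners avoid `V` and `u`. -/
theorem Placement.card_filePositions_sdiff_known (Z : Placement H r N B)
    {d : User H r → Fin N} (hd : Function.Injective d) (V : Finset (User H r)) {u : User H r}
    (hu : u ∉ V) :
    #(filePositions (d u) \ (Z.known d V ∪ Z u)) =
      ∑ W ∈ ((Finset.univ \ V).erase u).powerset, #(Z.subfile (d u) W) := by
  rw [Z.sum_card_subfile]
  refine (Finset.card_bij (fun b _ => (d u, b)) ?_ ?_ ?_).symm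
  · intro b hb
    simp only [Finset.mem_filter, Finset.mem_univ, true_and, Finset.mem_powerset,
      Finset.subset_iff, Placement.owners, Finset.mem_erase, Finset.mem_sdiff] at hb
    simp only [Finset.mem_sdiff, filePositions, Finset.mem_filter, Finset.mem_univ, true_and,
      Finset.mem_union, Placement.known]
    rintro (⟨k, hk, h | h⟩ | h)
    · exact (hb h).2 hk
    · exact hu (hd h ▸ hk)
    · exact (hb h).1 rfl
  · intro b _ b' _ h
    exact (Prod.ext_iff.1 h).2
  · rintro ⟨i, b⟩ hb
    simp only [Finset.mem_sdiff, filePositions, Finset.mem_filter, Finset.mem_univ, true_and,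
      Finset.mem_union, Placement.known, not_or, not_exists, not_and] at hb
    obtain ⟨rfl, h1, h2⟩ := hb
    refine ⟨b, ?_, rfl⟩
    simp only [Finset.mem_filter, Finset.mem_univ, true_and, Finset.mem_powerset,
      Finset.subset_iff, Placement.owners, Finset.mem_erase, Finset.mem_sdiff]
    intro k hk
    refine ⟨?_, fun hV => (h1 k hV).1 hk⟩
    rintro rfl
    exact h2 hk

/-- One step of the chain. The cache of `u` joins the conditioning, which can only lower the
entropy, and then `condEntropy_decode` reveals the file `d u`. -/
theorem Delivery.condEntropy_sent_insert {Z : Placement H r N B} (D : Delivery Z)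
    {d : User H r → Fin N} (hd : Function.Injective d) {V : Finset (User H r)} {u : User H r}
    (hu : u ∉ V) {J : Finset (Fin H)} (hJ : u.1 ⊆ J) {ε η : ℝ} (hη₀ : 0 < η) (hη₁ : η < 1)
    (herr : D.errorProb u (d u) ≤ ε) :
    (∑ W ∈ ((Finset.univ \ V).erase u).powerset, (#(Z.subfile (d u) W) : ℝ)) * Real.log 2 +
        condEntropy (D.sent J) (Z.known d (insert u V)) ≤
      condEntropy (D.sent J) (Z.known d V) +
        (-Real.log (1 - η) + ε * (B * Real.log 2 - Real.log η)) := by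
  have hZ : Z u ⊆ Z.known d V ∪ Z u := Finset.subset_union_right
  have key := condEntropy_decode (D.sent J) (Z.known d V ∪ Z u) (d u)
    (fun y => D.decode u (fun p => y.2 ⟨p.1, hZ p.2⟩)
      fun h => D.forward u h (y.1 ⟨h.1, hJ h.2⟩)) hη₀ hη₁ herr
  rw [Z.card_filePositions_sdiff_known hd V hu, ← Z.known_insert] at key
  have := condEntropy_anti (D.sent J) (Finset.subset_union_left (s₁ := Z.known d V) (s₂ := Z u))
  push_cast at key
  linarith

theorem acyclicSum_nil {U : Type*} [DecidableEq U] (x : Finset U → ℝ) (A : Finset U) :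
    acyclicSum x A [] = 0 := by
  simp [acyclicSum]

theorem acyclicSum_cons {U : Type*} [DecidableEq U] (x : Finset U → ℝ) (A : Finset U) (u : U)
    (p : List U) :
    acyclicSum x A (u :: p) =
      (∑ W ∈ (A.erase u).powerset, x W) + acyclicSum x (A.erase u) p := by
  unfold acyclicSum
  rw [List.length_cons, ← Finset.add_sum_Ioc_eq_sum_Icc (by omega)]
  have h1 : Finset.Ioc 1 (p.length + 1) = (Finset.Icc 1 p.length).image (· + 1) := by
    ext j
    simp only [Finset.mem_Ioc, Finset.mem_image, Finset.mem_Icc]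
    exact ⟨fun h => ⟨j - 1, by omega, by omega⟩, by rintro ⟨i, h, rfl⟩; omega⟩
  rw [h1, Finset.sum_image (by simp)]
  congr 1
  · simp [Finset.sdiff_singleton_eq_erase]
  · refine Finset.sum_congr rfl fun j _ => ?_
    rw [List.take_succ_cons, List.toFinset_cons, Finset.sdiff_insert, Finset.erase_sdiff_comm]

/-- The acyclic bound for the relays in `J` and the users in `p`, summed over a family of
demand vectors in which every user requests every file once. -/
theorem sum_condEntropy_sent_ge {Z : Placement H r N B} (hN : 0 < N) (hB : 0 < B)
    (D : Fin N → Delivery Z)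
    {d : Fin N → User H r → Fin N} (hd : ∀ t, Function.Injective (d t))
    (hd' : ∀ u, Function.Bijective fun t => d t u) {ε η : ℝ} (hη₀ : 0 < η) (hη₁ : η < 1)
    (herr : ∀ t u, (D t).errorProb u (d t u) ≤ ε) {J : Finset (Fin H)} (p : List (User H r))
    (hp : p.Nodup) (hJ : ∀ u ∈ p, u.1 ⊆ J) (V : Finset (User H r)) (hV : ∀ u ∈ p, u ∉ V) :
    N * B * acyclicSum Z.frac (Finset.univ \ V) p * Real.log 2 +
        ∑ t, condEntropy ((D t).sent J) (Z.known (d t) (V ∪ p.toFinset)) ≤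
      ∑ t, condEntropy ((D t).sent J) (Z.known (d t) V) +
        p.length * (N * (-Real.log (1 - η) + ε * (B * Real.log 2 - Real.log η))) := by
  induction p generalizing V with
  | nil => simp [acyclicSum_nil]
  | cons u p ih =>
    rw [List.nodup_cons] at hp
    have hu : u ∉ V := hV u (by simp)
    have ih' := ih hp.2 (fun v hv => hJ v (by simp [hv])) (insert u V) (fun v hv => by
      rw [Finset.mem_insert, not_or]
      exact ⟨fun h => hp.1 (h ▸ hv), hV v (by simp [hv])⟩)
    have step := Finset.sum_le_sum fun t (_ : t ∈ (Finset.univ : Finset (Fin N))) =>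
      (D t).condEntropy_sent_insert (hd t) hu (hJ u (by simp)) hη₀ hη₁ (herr t u)
    simp only [Finset.sum_add_distrib, ← Finset.sum_mul] at step
    rw [Finset.sum_comm] at step
    -- As `t` varies, `u` requests every file exactly once, so the sum runs over all files.
    have hfrac : ∀ W, ∑ t, (#(Z.subfile (d t u) W) : ℝ) = N * B * Z.frac W := by
      intro W
      rw [(hd' u).sum_comp (fun i => (#(Z.subfile i W) : ℝ))]
      have hNB : (N : ℝ) * B ≠ 0 := by positivity
      exact (mul_div_cancel₀ _ hNB).symm
    rw [Finset.sum_congr rfl fun W _ => hfrac W, ← Finset.mul_sum] at step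
    rw [acyclicSum_cons, List.toFinset_cons, Finset.union_insert, ← Finset.insert_union]
    have hA : (Finset.univ \ V).erase u = Finset.univ \ insert u V := by
      rw [Finset.sdiff_insert]
    rw [hA] at step ⊢
    simp only [Finset.sum_const, Finset.card_univ, Fintype.card_fin, nsmul_eq_mul] at step
    simp only [List.length_cons, Nat.cast_add, Nat.cast_one]
    linarith

end Network

/-! ### The converse for a single placement. -/

variable {H r N B : ℕ}

/-- The converse for one placement, with an explicit error term. -/
theorem acyclicSum_le_of_supports (hN : Fintype.card (User H r) ≤ N) (hN₀ : 0 < N) (hB : 0 < B)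
    {Z : Placement H r N B} {R ε η : ℝ} (hη₀ : 0 < η) (hη₁ : η < 1) (hZ : Z.Supports R ε)
    {Q : Finset (Fin H)} {a : ℕ} {P : Fin a → Finset (Fin H)} (hP : IsBlockPartition r Q P)
    {p : Fin a → List (User H r)} {q : List (User H r)}
    (hp : ∀ i, IsPermutationOf (p i) (usersWithin r (P i)))
    (hq : IsPermutationOf q (usersWithin r Q \ blockUsers r P)) :
    (∑ i, acyclicSum Z.frac Finset.univ (p i)) +
        acyclicSum Z.frac (Finset.univ \ blockUsers r P) q ≤
      #Q * R + ((∑ i, ((p i).length : ℝ)) + q.length) *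
        ((-Real.log (1 - η) + ε * (B * Real.log 2 - Real.log η)) / (B * Real.log 2)) := by
  have : NeZero N := ⟨hN₀.ne'⟩
  obtain ⟨e⟩ := Function.Embedding.nonempty_of_card_le
    (α := User H r) (β := Fin N) (by simpa using hN)
  -- Addition is modulo `N`: each shift keeps the demands distinct, and each user runs through all
  -- files.
  set d : Fin N → User H r → Fin N := fun t u => e u + t with hd_def
  have hd : ∀ t, Function.Injective (d t) := fun t u v h => e.injective (add_right_cancel h)
  have hd' : ∀ u, Function.Bijective fun t => d t u := fun u => (Equiv.addLeft (e u)).bijective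
  choose D hload herr using fun t => hZ (d t)
  set c : ℝ := -Real.log (1 - η) + ε * (B * Real.log 2 - Real.log η) with hc
  have hlog : 0 < Real.log 2 := Real.log_pos (by norm_num)
  have hpset : ∀ i, (p i).toFinset = usersWithin r (P i) := fun i => by
    ext u; rw [List.mem_toFinset, (hp i).2]
  have hblock : ∀ i, usersWithin r (P i) ⊆ blockUsers r P := fun i =>
    Finset.subset_biUnion_of_mem (fun i => usersWithin r (P i)) (Finset.mem_univ i)
  -- After the chain of a block, the conditioning is enlarged to the knowledge of all block users,
  -- common to every `i`.
  have hchain : ∀ i, N * B * acyclicSum Z.frac Finset.univ (p i) * Real.log 2 +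
      ∑ t, condEntropy ((D t).sent (P i)) (Z.known (d t) (blockUsers r P)) ≤
      ∑ t, condEntropy ((D t).sent (P i)) ∅ + (p i).length * (N * c) := by
    intro i
    have key := sum_condEntropy_sent_ge hN₀ hB D hd hd' hη₀ hη₁ herr (J := P i) (p i) (hp i).1
      (fun u hu => (Finset.mem_filter.1 (((hp i).2 u).1 hu)).2) ∅ (fun _ _ => by simp)
    rw [Finset.sdiff_empty, Finset.empty_union, hpset] at key
    have h0 : ∀ t, Z.known (d t) ∅ = ∅ := fun t => by simp [Placement.known]
    simp only [h0] at key
    have := Finset.sum_le_sum fun t (_ : t ∈ (Finset.univ : Finset (Fin N))) =>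
      condEntropy_anti ((D t).sent (P i)) (Z.known_mono (d t) (hblock i))
    linarith
  have hchain_q : N * B * acyclicSum Z.frac (Finset.univ \ blockUsers r P) q * Real.log 2 ≤
      ∑ t, condEntropy ((D t).sent Q) (Z.known (d t) (blockUsers r P)) + q.length * (N * c) := by
    have hmem : ∀ u ∈ q, u ∈ usersWithin r Q \ blockUsers r P := fun u hu => (hq.2 u).1 hu
    have key := sum_condEntropy_sent_ge hN₀ hB D hd hd' hη₀ hη₁ herr (J := Q) q hq.1
      (fun u hu => (Finset.mem_filter.1 (Finset.mem_sdiff.1 (hmem u hu)).1).2) (blockUsers r P)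
      (fun u hu => (Finset.mem_sdiff.1 (hmem u hu)).2)
    have := Finset.sum_nonneg fun t (_ : t ∈ (Finset.univ : Finset (Fin N))) =>
      condEntropy_nonneg ((D t).sent Q) (Z.known (d t) (blockUsers r P ∪ q.toFinset))
    linarith
  -- With a common conditioning, the remainders of the blocks join into one entropy for all of `Q`.
  have hjoin : ∑ t, condEntropy ((D t).sent Q) (Z.known (d t) (blockUsers r P)) ≤
      ∑ i, ∑ t, condEntropy ((D t).sent (P i)) (Z.known (d t) (blockUsers r P)) := by
    rw [Finset.sum_comm]
    refine Finset.sum_le_sum fun t _ => ?_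
    have := (D t).condEntropy_sent_biUnion_le Finset.univ P (Z.known (d t) (blockUsers r P))
    rwa [hP.2.2] at this
  have hload' : ∑ i, ∑ t, condEntropy ((D t).sent (P i)) ∅ ≤
      N * (#Q * (R * B * Real.log 2)) := by
    calc _ ≤ ∑ i, ∑ _t : Fin N, #(P i) * (R * B * Real.log 2) :=
          Finset.sum_le_sum fun i _ => Finset.sum_le_sum fun t _ =>
            (D t).entropy_sent_le (hload t) (P i)
      _ = N * ((∑ i, (#(P i) : ℝ)) * (R * B * Real.log 2)) := by
          simp only [Finset.sum_const, Finset.card_univ, Fintype.card_fin, nsmul_eq_mul]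
          rw [← Finset.mul_sum, Finset.sum_mul]
      _ = _ := by
          rw [← hP.2.2, Finset.card_biUnion fun i _ j _ hij => hP.2.1 i j hij]
          push_cast
          rfl
  have hsum := Finset.sum_le_sum fun i (_ : i ∈ (Finset.univ : Finset (Fin a))) => hchain i
  simp only [Finset.sum_add_distrib, ← Finset.sum_mul, ← Finset.mul_sum] at hsum hjoin hload'
  have hpos : (0 : ℝ) < N * (B * Real.log 2) := by positivity
  rw [← mul_le_mul_iff_right₀ hpos]
  have hR : N * (B * Real.log 2) * (#Q * R + ((∑ i, ((p i).length : ℝ)) + q.length) *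
      (c / (B * Real.log 2))) = N * (#Q * (R * B * Real.log 2)) +
      ((∑ i, ((p i).length : ℝ)) + q.length) * (N * c) := by
    field_simp
  rw [hR]
  linarith

theorem IsPermutationOf.length_le {U : Type*} [Fintype U] {p : List U} {S : Finset U}
    (hp : IsPermutationOf p S) : p.length ≤ Fintype.card U := hp.1.length_le_card

/-- The converse for every placement, up to a term vanishing with the error probability. -/
theorem exists_error_acyclicSum_le (hN : Fintype.card (User H r) ≤ N) (hN₀ : 0 < N) {δ : ℝ}
    (hδ : 0 < δ) : ∃ ε : ℝ, 0 < ε ∧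
      ∀ (B : ℕ), 0 < B → ∀ (Z : Placement H r N B) (R : ℝ), Z.Supports R ε →
      ∀ (Q : Finset (Fin H)) (a : ℕ), a ≤ H →
      ∀ P : Fin a → Finset (Fin H), IsBlockPartition r Q P →
      ∀ (p : Fin a → List (User H r)) (q : List (User H r)),
      (∀ i, IsPermutationOf (p i) (usersWithin r (P i))) →
      IsPermutationOf q (usersWithin r Q \ blockUsers r P) →
      (∑ i, acyclicSum Z.frac Finset.univ (p i)) +
          acyclicSum Z.frac (Finset.univ \ blockUsers r P) q ≤ #Q * R + δ := by
  have hlog : 0 < Real.log 2 := Real.log_pos (by norm_num)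
  -- Bounds the total length of at most `H` block orderings and the last one; the extra `1` keeps
  -- `m` positive.
  set m : ℝ := (H + 1) * (Fintype.card (User H r)) + 1 with hm
  have hm0 : 0 < m := by positivity
  set κ : ℝ := δ * Real.log 2 / m / 2 with hκ
  have hκ0 : 0 < κ := by positivity
  -- Makes `-log (1 - η) = κ`. With `ε = κ / (log 2 - log η)` and `1 ≤ B`, both parts of Fano's term
  -- are at most `κ * B`, and `2 * κ * B` is `δ / m` times `B * log 2`.
  set η : ℝ := 1 - Real.exp (-κ) with hη
  have hexp : Real.exp (-κ) < 1 := by rw [Real.exp_lt_one_iff]; linarith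
  have hη₀ : 0 < η := by linarith
  have hη₁ : η < 1 := by linarith [Real.exp_pos (-κ)]
  have hlogη : 0 < -Real.log η := by linarith [Real.log_neg hη₀ hη₁]
  have hs : 0 < Real.log 2 - Real.log η := by linarith
  refine ⟨κ / (Real.log 2 - Real.log η), by positivity, ?_⟩
  intro B hB Z R hZ Q a ha P hP p q hp hq
  refine (acyclicSum_le_of_supports hN hN₀ hB hη₀ hη₁ hZ hP hp hq).trans ?_
  gcongr
  have hB1 : (1 : ℝ) ≤ B := by exact_mod_cast hB
  have hlen : (∑ i, ((p i).length : ℝ)) + q.length ≤ m := by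
    have h1 : ∑ i, ((p i).length : ℝ) ≤ ∑ _i : Fin a, (Fintype.card (User H r) : ℝ) :=
      Finset.sum_le_sum fun i _ => by exact_mod_cast (hp i).length_le
    have h2 : (q.length : ℝ) ≤ Fintype.card (User H r) := by exact_mod_cast hq.length_le
    simp only [Finset.sum_const, Finset.card_univ, Fintype.card_fin, nsmul_eq_mul] at h1
    have h3 : (a : ℝ) * Fintype.card (User H r) ≤ H * Fintype.card (User H r) := by gcongr
    linarith
  have h1η : -Real.log (1 - η) = κ := by rw [hη, sub_sub_cancel, Real.log_exp, neg_neg]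
  have hterm : (-Real.log (1 - η) + κ / (Real.log 2 - Real.log η) *
      (B * Real.log 2 - Real.log η)) / (B * Real.log 2) ≤ δ / m := by
    rw [h1η, div_le_iff₀ (by positivity)]
    have h4 : κ / (Real.log 2 - Real.log η) * (B * Real.log 2 - Real.log η) ≤ κ * B := by
      rw [div_mul_eq_mul_div, div_le_iff₀ hs, mul_assoc]
      gcongr
      nlinarith
    have h5 : δ / m * (B * Real.log 2) = 2 * κ * B := by rw [hκ]; field_simp
    nlinarith
  calc _ ≤ m * (δ / m) := by
        refine mul_le_mul hlen hterm ?_ hm0.le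
        refine div_nonneg ?_ (by positivity)
        rw [h1η]
        have : 0 < B * Real.log 2 - Real.log η := by
          have : 0 < B * Real.log 2 := by positivity
          linarith
        positivity
    _ = δ := by field_simp

/-! ### Achievability, optimal profiles and limits. -/

/-- Without caching, a server that sends the whole library on every link supports the load `N`. -/
theorem achievableUncoded_card (hr : 1 ≤ r) {M : ℝ} (hM : 0 ≤ M) :
    AchievableUncoded H r N M N := by
  intro ε hε
  refine ⟨1, one_pos, fun _ => ∅, fun _ => by simpa using hM, fun d => ?_⟩
  have relay : ∀ k : User H r, ∃ h, h ∈ k.1 := fun k =>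
    Finset.card_pos.1 (by rw [k.2]; exact hr)
  choose relay hrelay using relay
  refine ⟨{ linkLen := fun _ => N
            edgeLen := fun _ _ => N
            encode := fun _ F i => F i 0
            forward := fun _ _ X => X
            decode := fun k _ Y _ => Y ⟨relay k, hrelay k⟩ (d k) }, ⟨by simp, by simp⟩, fun k => ?_⟩
  refine le_of_eq_of_le ?_ hε.le
  rw [Delivery.errorProb, div_eq_zero_iff]
  left
  rw [Nat.cast_eq_zero, Finset.card_eq_zero, Finset.filter_eq_empty_iff]
  intro F _
  rw [not_not]
  funext b
  rw [Subsingleton.elim b 0]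
  rfl

/-- Loads above the optimal one are supported, with arbitrarily small error probability. -/
theorem exists_supports_optLoadUncoded_add (hne : ∃ R, AchievableUncoded H r N M R) {ε : ℝ}
    (hε : 0 < ε) :
    ∃ B : ℕ, 0 < B ∧ ∃ Z : Placement H r N B, Z.CacheSize M ∧
      Z.Supports (optLoadUncoded H r N M + ε) ε := by
  obtain ⟨R, hR, hlt⟩ := Real.lt_sInf_add_pos (s := {R | AchievableUncoded H r N M R}) hne hε
  obtain ⟨B, hB, Z, h1, h2⟩ := hR ε hε
  exact ⟨B, hB, Z, h1, h2.mono hlt.le le_rfl⟩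

open Filter Topology in
theorem exists_isOptimalProfile (hN : 0 < N) {M : ℝ}
    (hne : ∃ R, AchievableUncoded H r N M R) :
    ∃ x : Finset (User H r) → ℝ, IsOptimalProfile N M x := by
  have hpos : ∀ n : ℕ, (0 : ℝ) < 1 / (n + 1) := fun n => by positivity
  choose B hB Z hZ hS using fun n : ℕ => exists_supports_optLoadUncoded_add hne (hpos n)
  -- The profiles lie in a finite-dimensional cube, so a subsequence converges; along it the excess
  -- load and the error still vanish.
  obtain ⟨x, -, φ, hφ, hx⟩ := (isCompact_univ_pi fun _ : Finset (User H r) =>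
    isCompact_Icc (a := (0 : ℝ)) (b := 1)).tendsto_subseq (x := fun n => (Z n).frac)
    (fun n W _ => ⟨(Z n).frac_nonneg W, (Z n).frac_le_one hN (hB n) W⟩)
  refine ⟨x, fun ε hε => ?_⟩
  have h1 : ∀ᶠ n in atTop, (1 : ℝ) / (φ n + 1) ≤ ε :=
    ((tendsto_one_div_add_atTop_nhds_zero_nat.comp hφ.tendsto_atTop).eventually_lt_const
      hε).mono fun n h => le_of_lt h
  have h2 : ∀ᶠ n in atTop, ∀ W, |(Z (φ n)).frac W - x W| ≤ ε := by
    rw [eventually_all]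
    intro W
    have := (tendsto_pi_nhds.1 hx W).eventually (Metric.closedBall_mem_nhds _ hε)
    exact this.mono fun n h => by simpa [Real.dist_eq] using h
  obtain ⟨n, hn1, hn2⟩ := (h1.and h2).exists
  exact ⟨B (φ n), hB _, Z (φ n), hZ _, (hS _).mono (by linarith) hn1, hn2⟩

open Filter Topology in
/-- An optimal profile is the limit of the profiles of placements attaining the optimal load. -/
theorem IsOptimalProfile.exists_seq {M : ℝ} {x : Finset (User H r) → ℝ}
    (hx : IsOptimalProfile N M x) :
    ∃ (B : ℕ → ℕ) (Z : ∀ n, Placement H r N (B n)), (∀ n, 0 < B n) ∧ (∀ n, (Z n).CacheSize M) ∧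
      (∀ n : ℕ, (Z n).Supports (optLoadUncoded H r N M + 1 / (n + 1)) (1 / (n + 1))) ∧
      ∀ W, Tendsto (fun n => (Z n).frac W) atTop (𝓝 (x W)) := by
  choose B hB Z hZ hS hW using fun n : ℕ => hx (1 / (n + 1)) (by positivity)
  refine ⟨B, Z, hB, hZ, hS, fun W => ?_⟩
  rw [tendsto_iff_dist_tendsto_zero]
  exact squeeze_zero (fun _ => dist_nonneg) (fun n => hW n W)
    tendsto_one_div_add_atTop_nhds_zero_nat

open Filter Topology in
theorem tendsto_acyclicSum {U : Type*} [DecidableEq U] {y : ℕ → Finset U → ℝ} {x : Finset U → ℝ}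
    (h : ∀ W, Tendsto (fun n => y n W) atTop (𝓝 (x W))) (A : Finset U) (p : List U) :
    Tendsto (fun n => acyclicSum (y n) A p) atTop (𝓝 (acyclicSum x A p)) :=
  tendsto_finsetSum _ fun _ _ => tendsto_finsetSum _ fun W _ => h W

end CombinationNetwork

open Filter Topology CombinationNetwork in
theorem mainTheorem5 (H r N : ℕ) (M : ℝ) (hr : 1 ≤ r) (hrH : r ≤ H)
    (hN : Fintype.card (CombinationNetwork.User H r) ≤ N) (hM₀ : 0 ≤ M) (hM₁ : M ≤ N) :
    (∃ x : Finset (CombinationNetwork.User H r) → ℝ,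
      CombinationNetwork.IsOptimalProfile N M x) ∧
    (∀ x : Finset (CombinationNetwork.User H r) → ℝ,
      CombinationNetwork.IsOptimalProfile N M x →
      (∀ W, 0 ≤ x W) ∧ ∑ W, x W = 1 ∧
      (∀ k, ∑ W with k ∈ W, x W ≤ M / N) ∧
      ∀ (Q : Finset (Fin H)) (a : ℕ), a ∈ Finset.Icc 1 (Q.card / r) →
      ∀ P : Fin a → Finset (Fin H), CombinationNetwork.IsBlockPartition r Q P →
      ∀ (p : Fin a → List (CombinationNetwork.User H r))
        (q : List (CombinationNetwork.User H r)),
      (∀ i, CombinationNetwork.IsPermutationOf (p i) (CombinationNetwork.usersWithin r (P i))) →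
      CombinationNetwork.IsPermutationOf q
        (CombinationNetwork.usersWithin r Q \ CombinationNetwork.blockUsers r P) →
      (Q.card : ℝ) * CombinationNetwork.optLoadUncoded H r N M ≥
        (∑ i, CombinationNetwork.acyclicSum x Finset.univ (p i)) +
          CombinationNetwork.acyclicSum x
            (Finset.univ \ CombinationNetwork.blockUsers r P) q) ∧
    (∀ δ : ℝ, 0 < δ → ∃ ε : ℝ, 0 < ε ∧
      ∀ (B : ℕ), 0 < B → ∀ (Z : CombinationNetwork.Placement H r N B) (R : ℝ),
      Z.Supports R ε →
      ∀ (Q : Finset (Fin H)) (a : ℕ), a ∈ Finset.Icc 1 (Q.card / r) →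
      ∀ P : Fin a → Finset (Fin H), CombinationNetwork.IsBlockPartition r Q P →
      ∀ (p : Fin a → List (CombinationNetwork.User H r))
        (q : List (CombinationNetwork.User H r)),
      (∀ i, CombinationNetwork.IsPermutationOf (p i) (CombinationNetwork.usersWithin r (P i))) →
      CombinationNetwork.IsPermutationOf q
        (CombinationNetwork.usersWithin r Q \ CombinationNetwork.blockUsers r P) →
      (Q.card : ℝ) * R + δ ≥
        (∑ i, CombinationNetwork.acyclicSum Z.frac Finset.univ (p i)) +
          CombinationNetwork.acyclicSum Z.frac
            (Finset.univ \ CombinationNetwork.blockUsers r P) q) := by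
  have hH : 0 < H := by omega
  have hN₀ : 0 < N := by
    rw [card_user] at hN
    exact (Nat.choose_pos hrH).trans_le hN
  have hne : ∃ R, AchievableUncoded H r N M R := ⟨N, achievableUncoded_card hr hM₀⟩
  have haH : ∀ (Q : Finset (Fin H)) (a : ℕ), a ∈ Finset.Icc 1 (Q.card / r) → a ≤ H := by
    intro Q a ha
    have h1 := Finset.card_le_univ Q
    rw [Fintype.card_fin] at h1
    exact (Finset.mem_Icc.1 ha).2.trans ((Nat.div_le_self _ _).trans h1)
  refine ⟨exists_isOptimalProfile hN₀ hne, fun x hx => ?_, fun δ hδ => ?_⟩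
  · obtain ⟨B, Z, hB, hZ, hS, hlim⟩ := hx.exists_seq
    refine ⟨fun W => ge_of_tendsto' (hlim W) fun n => (Z n).frac_nonneg W, ?_, fun k => ?_, ?_⟩
    · refine tendsto_nhds_unique (tendsto_finsetSum _ fun W _ => hlim W) ?_
      simp only [fun n => (Z n).sum_frac_univ hN₀ (hB n)]
      exact tendsto_const_nhds
    · exact le_of_tendsto' (tendsto_finsetSum _ fun W _ => hlim W)
        fun n => (hZ n).sum_frac_le hN₀ (hB n) k
    · intro Q a ha P hP p q hp hq
      refine le_of_forall_pos_le_add fun δ hδ => ?_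
      -- `ε` depends on `δ` but not on `n` or the file size, so `n` tends to infinity with `δ`
      -- fixed.
      obtain ⟨ε, hε, hbound⟩ := exists_error_acyclicSum_le (H := H) (r := r) hN hN₀ hδ
      have hsmall : ∀ᶠ n : ℕ in atTop, (1 : ℝ) / (n + 1) ≤ ε :=
        (tendsto_one_div_add_atTop_nhds_zero_nat.eventually_lt_const hε).mono fun n h => h.le
      have hlim_R : Tendsto (fun n : ℕ => (Q.card : ℝ) *
          (optLoadUncoded H r N M + 1 / ((n : ℝ) + 1)) + δ) atTop
          (𝓝 ((Q.card : ℝ) * (optLoadUncoded H r N M + 0) + δ)) :=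
        ((tendsto_one_div_add_atTop_nhds_zero_nat.const_add _).const_mul _).add_const _
      rw [add_zero] at hlim_R
      refine le_of_tendsto_of_tendsto
        ((tendsto_finsetSum _ fun i _ => tendsto_acyclicSum hlim _ (p i)).add
          (tendsto_acyclicSum hlim _ q)) hlim_R ?_
      filter_upwards [hsmall] with n hn
      exact hbound (B n) (hB n) (Z n) _ ((hS n).mono le_rfl hn) Q a (haH Q a ha) P hP p q hp hq
  · obtain ⟨ε, hε, hbound⟩ := exists_error_acyclicSum_le (H := H) (r := r) hN hN₀ hδ
    exact ⟨ε, hε, fun B hB Z R hZ Q a ha P hP p q hp hq =>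
      hbound B hB Z R hZ Q a (haH Q a ha) P hP p q hp hq⟩
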